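/- Let $\mathbb{K}$ be an ordered field which is maximal ordered (i.e. real closed: every positive element is a square and every polynomial of odd degree over $\mathbb{K}$ has a root in $\mathbb{K}$) and Cauchy complete, and whose order topology has a countable basis of neighbourhoods of $0$. Let $\mathbb{L}\subset\mathbb{K}$ be a subfield such that some element of $\mathbb{K}$ is larger than every element of $\mathbb{L}$ (in particular $\mathbb{K}$ is non-Archimedean; if $\mathbb{K}$ is non-Archimedean, one can take $\mathbb{L}=\mathbb{Q}$). Put $$A=\{x\in\mathbb{K} : |x|\le a \text{ for some } a\in\mathbb{L},\ a>0\},\qquad M=\{x\in\mathbb{K} : |x|<a \text{ for all } a\in\mathbb{L},\ a>0\},$$ the ring of elements that are not infinitely large with respect to $\mathbb{L}$ and its ideal of infinitesimals, and give $A$ the topology induced by the order topology of $\mathbb{K}$. A power series over $A$ is called restricted if its coefficients tend to $0$, and $M\{X\}$ denotes the set of restricted power series all of whose coefficients lie in $M$. Let $S(X)=\sum_{n\ge 0}a_nX^n$ be a restricted power series over $A$ and let $N\ge 0$ be such that the partial sum $S_N(X)=\sum_{n=0}^{N}a_nX^n$ is a monic polynomial and $a_{N+h}\in M$ for all $h\ge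 1$. Then $S(X)=P(X)B(X)$, where $P(X)\in A[X]$ is a monic polynomial with $P(X)\equiv S_N(X) \bmod M$, and $B(X)\in 1+M\{X\}$ is a restricted power series. -/

import Mathlib

namespace OrderedValuation

variable {K : Type*} [Field K] [LinearOrder K] [IsStrictOrderedRing K]

/-- The ordered field `K` is non-comparable with (non-Archimedean over) its subfield `L`:
some element of `K` is larger than every element of `L`. -/
def NonComparable (L : Subfield K) : Prop :=
  ∃ x : K, ∀ a ∈ L, a < x

/-- `x` is infinitely large with respect to `L`: `|x| > a` for every positive `a ∈ L`. -/
def IsInfinitelyLarge (L : Subfield K) (x : K) : Prop :=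
  ∀ a ∈ L, 0 < a → a < |x|

/-- `x` is infinitely small with respect to `L`, or zero: `|x| < a` for every positive `a ∈ L`. -/
def IsInfinitesimal (L : Subfield K) (x : K) : Prop :=
  ∀ a ∈ L, 0 < a → |x| < a

theorem not_isInfinitelyLarge_iff {L : Subfield K} {x : K} :
    ¬ IsInfinitelyLarge L x ↔ ∃ a ∈ L, 0 < a ∧ |x| ≤ a := by
  simp [IsInfinitelyLarge]

/-- The ring `A_L` of the elements of `K` that are not infinitely large with respect to `L`. -/
def finiteRing (L : Subfield K) : Subring K where
  carrier := {x | ¬ IsInfinitelyLarge L x}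
  zero_mem' := not_isInfinitelyLarge_iff.2 ⟨1, L.one_mem, one_pos, by simp⟩
  one_mem' := not_isInfinitelyLarge_iff.2 ⟨1, L.one_mem, one_pos, by simp⟩
  neg_mem' := by
    intro x hx
    obtain ⟨a, ha, h0, h⟩ := not_isInfinitelyLarge_iff.1 hx
    exact not_isInfinitelyLarge_iff.2 ⟨a, ha, h0, by rwa [abs_neg]⟩
  add_mem' := by
    intro x y hx hy
    obtain ⟨a, ha, ha0, hxa⟩ := not_isInfinitelyLarge_iff.1 hx
    obtain ⟨b, hb, hb0, hyb⟩ := not_isInfinitelyLarge_iff.1 hy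
    exact not_isInfinitelyLarge_iff.2
      ⟨a + b, L.add_mem ha hb, add_pos ha0 hb0, (abs_add_le x y).trans (add_le_add hxa hyb)⟩
  mul_mem' := by
    intro x y hx hy
    obtain ⟨a, ha, ha0, hxa⟩ := not_isInfinitelyLarge_iff.1 hx
    obtain ⟨b, hb, hb0, hyb⟩ := not_isInfinitelyLarge_iff.1 hy
    refine not_isInfinitelyLarge_iff.2 ⟨a * b, L.mul_mem ha hb, mul_pos ha0 hb0, ?_⟩
    rw [abs_mul]
    exact mul_le_mul hxa hyb (abs_nonneg y) ha0.le

/-- The ideal `M_L` of `A_L` formed by the infinitesimal elements (zero included). -/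
def infinitesimalIdeal (L : Subfield K) : Ideal (finiteRing L) where
  carrier := {x | IsInfinitesimal L (x : K)}
  zero_mem' := by
    intro a _ h0
    simpa using h0
  add_mem' := by
    intro x y hx hy a ha h0
    have h2 : a / 2 ∈ L := L.div_mem ha (by exact_mod_cast natCast_mem L 2)
    have h1 := hx (a / 2) h2 (half_pos h0)
    have h3 := hy (a / 2) h2 (half_pos h0)
    calc |((x + y : finiteRing L) : K)| ≤ |(x : K)| + |(y : K)| := by
          simpa using abs_add_le (x : K) (y : K)
      _ < a / 2 + a / 2 := add_lt_add h1 h3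
      _ = a := add_halves a
  smul_mem' := by
    intro c x hx a ha h0
    obtain ⟨b, hb, hb0, hcb⟩ := not_isInfinitelyLarge_iff.1 c.2
    have h1 := hx (a / b) (L.div_mem ha hb) (div_pos h0 hb0)
    calc |((c • x : finiteRing L) : K)| = |(c : K)| * |(x : K)| := by
          simp [abs_mul]
      _ ≤ b * |(x : K)| := mul_le_mul_of_nonneg_right hcb (abs_nonneg _)
      _ < b * (a / b) := mul_lt_mul_of_pos_left h1 hb0
      _ = a := by field_simp

end OrderedValuation

namespace RestrictedSeries

open Filter Topology

variable {R : Type*} [CommRing R] [TopologicalSpace R]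

/-- A power series over a topological ring is restricted if its coefficients tend to `0`. -/
def IsRestricted (F : PowerSeries R) : Prop :=
  Tendsto (fun n : ℕ => PowerSeries.coeff n F) atTop (𝓝 0)

/-- `I{X}`: the restricted power series all of whose coefficients lie in the ideal `I`. -/
def restrictedIn (I : Ideal R) : Set (PowerSeries R) :=
  {F | IsRestricted F ∧ ∀ n : ℕ, PowerSeries.coeff n F ∈ I}

end RestrictedSeries

/-! Approximate `S` by its truncations `F n`, factor these over `A`, and pass to the limit.
Existence for polynomials: over a real closed field irreducible factors are linear, or quadratic
with negative discriminant. After extracting a constant, each is either monic over `A` or congruent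
to `1` mod `M` (`hasSplitting`). If the reduction of `F` mod `M` is monic, the total constant must
be `1` mod `M`, so `F = P * B` (`exists_monic_mul_eq`). Uniqueness: by Nakayama, if two such
products agree modulo an ideal `J`, so do their factors (`map_eq_and_map_eq_of_map_mul_eq`). Limit:
the nonzero principal ideals of `A` form a neighbourhood basis of `0`. Taking them as `J`, the
factors of `F n` are Cauchy, uniformly in the coefficient index. The limits exist by completeness,
and the uniformity makes the limit of the `B n` restricted. -/

section RealClosed

/-! ### Irreducible polynomials over real closed fields -/

open Polynomial IntermediateField Module

/-- A monic irreducible quadratic polynomial has a discriminant that is not a square. -/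
theorem Polynomial.not_isSquare_discrim_of_irreducible {F : Type*} [Field F] [NeZero (2 : F)]
    {p : F[X]} (hp : Irreducible p) (hm : p.Monic) (hd : p.natDegree = 2) :
    ¬ IsSquare (p.coeff 1 ^ 2 - 4 * p.coeff 0) := by
  rintro ⟨d, h⟩
  have h2 : (2 : F) ≠ 0 := NeZero.ne 2
  have hc : p.coeff 2 = 1 := by rw [← hd]; exact hm
  have hr : p.IsRoot ((-p.coeff 1 + d) / 2) := by
    rw [IsRoot.def, eval_eq_sum_range, hd]
    simp only [Finset.sum_range_succ, Finset.sum_range_zero, hc]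
    field_simp
    linear_combination -h
  have h1 : p.natDegree = 1 :=
    natDegree_eq_of_degree_eq_some (degree_eq_one_of_irreducible_of_root hp hr)
  omega

/-- A field all of whose elements are squares has no Galois extension of degree `2 ^ n`
other than itself. -/
theorem IsGalois.finrank_eq_one_of_forall_isSquare {F E : Type*} [Field F] [Field E] [Algebra F E]
    [NeZero (2 : F)] [FiniteDimensional F E] [IsGalois F E] (hsq : ∀ x : F, IsSquare x)
    {n : ℕ} (hn : finrank F E ∣ 2 ^ n) : finrank F E = 1 := by
  obtain ⟨m, -, hm⟩ := (Nat.dvd_prime_pow Nat.prime_two).1 hn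
  rcases m with _ | m
  · simpa using hm
  exfalso
  have : Fact (Nat.Prime 2) := ⟨Nat.prime_two⟩
  -- A subgroup of index 2 gives a quadratic subextension, hence a nonsquare discriminant in `F`.
  obtain ⟨H, hH⟩ := Sylow.exists_subgroup_card_pow_prime (G := Gal(E/F)) 2 (n := m)
    (by rw [IsGalois.card_aut_eq_finrank, hm, pow_succ]; exact dvd_mul_right _ _)
  have h1 : finrank (fixedField H) E = 2 ^ m := by
    rw [IntermediateField.finrank_fixedField_eq_card, hH]
  have h2 : finrank F (fixedField H) = 2 := by
    have h := finrank_mul_finrank F (fixedField H) E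
    rw [h1, hm, pow_succ, mul_comm] at h
    exact Nat.eq_of_mul_eq_mul_left (by positivity) h
  obtain ⟨α, hα⟩ := Field.exists_primitive_element F (fixedField H)
  have hi : IsIntegral F α := IsIntegral.of_finite F α
  have hd : (minpoly F α).natDegree = 2 := by
    rw [← adjoin.finrank hi, hα, finrank_top', h2]
  exact not_isSquare_discrim_of_irreducible (minpoly.irreducible hi) (minpoly.monic hi) hd (hsq _)

theorem IntermediateField.exists_eq_add_mul_of_mem_adjoin_of_sq_eq_neg_one {K E : Type*} [Field K]
    [Field E] [Algebra K E]
    [FiniteDimensional K E] {i : E} (hi : i ^ 2 = -1) {z : E} (hz : z ∈ K⟮i⟯) :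
    ∃ a b : K, z = algebraMap K E a + algebraMap K E b * i := by
  rw [← IntermediateField.mem_toSubalgebra,
    adjoin_simple_toSubalgebra_of_isAlgebraic (IsAlgebraic.of_finite K i)] at hz
  induction hz using Algebra.adjoin_induction with
  | mem x hx => exact ⟨0, 1, by simpa using hx⟩
  | algebraMap r => exact ⟨r, 0, by simp⟩
  | add x y _ _ hx hy =>
    obtain ⟨a, b, rfl⟩ := hx
    obtain ⟨c, d, rfl⟩ := hy
    exact ⟨a + c, b + d, by simp only [map_add]; ring⟩
  | mul x y _ _ hx hy =>
    obtain ⟨a, b, rfl⟩ := hx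
    obtain ⟨c, d, rfl⟩ := hy
    refine ⟨a * c - b * d, a * d + b * c, ?_⟩
    simp only [map_add, map_sub, map_mul]
    linear_combination (algebraMap K E b * algebraMap K E d) * hi

namespace IsRealClosed

variable {K : Type*} [Field K] [LinearOrder K] [IsStrictOrderedRing K] [IsRealClosed K]

/-- A Galois extension of a real closed field has degree a power of two. -/
theorem exists_finrank_eq_two_pow (E : Type*) [Field E] [Algebra K E] [FiniteDimensional K E]
    [IsGalois K E] : ∃ n : ℕ, finrank K E = 2 ^ n := by
  have : Fact (Nat.Prime 2) := ⟨Nat.prime_two⟩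
  obtain ⟨P⟩ : Nonempty (Sylow 2 Gal(E/K)) := inferInstance
  obtain ⟨n, hn⟩ := (IsPGroup.iff_card).1 P.2
  refine ⟨n, ?_⟩
  have h1 : finrank (fixedField (P : Subgroup Gal(E/K))) E = 2 ^ n := by
    rw [IntermediateField.finrank_fixedField_eq_card]; exact hn
  have h2 : finrank K (fixedField (P : Subgroup Gal(E/K))) = (P : Subgroup Gal(E/K)).index := by
    have h := finrank_mul_finrank K (fixedField (P : Subgroup Gal(E/K))) E
    have h' := (P : Subgroup Gal(E/K)).card_mul_index
    rw [IsGalois.card_aut_eq_finrank, ← h, ← finrank_fixedField_eq_card, mul_comm] at h'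
    exact (Nat.eq_of_mul_eq_mul_right finrank_pos h').symm
  -- The Sylow fixed field has odd degree; the minimal polynomial of a generator then has a root in
  -- `K`, so this degree is 1.
  have hodd : Odd (finrank K (fixedField (P : Subgroup Gal(E/K)))) := by
    rw [h2, ← Nat.not_even_iff_odd, even_iff_two_dvd]
    exact P.not_dvd_index
  obtain ⟨α, hα⟩ := Field.exists_primitive_element K (fixedField (P : Subgroup Gal(E/K)))
  have hi : IsIntegral K α := IsIntegral.of_finite K α
  have hd : (minpoly K α).natDegree = finrank K (fixedField (P : Subgroup Gal(E/K))) := by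
    rw [← adjoin.finrank hi, hα, finrank_top']
  rw [← hd] at hodd
  obtain ⟨x, hx⟩ := exists_isRoot_of_odd_natDegree hodd
  have h3 : (minpoly K α).natDegree = 1 := natDegree_eq_of_degree_eq_some
    (degree_eq_one_of_irreducible_of_root (minpoly.irreducible hi) hx)
  rw [← finrank_mul_finrank K (fixedField (P : Subgroup Gal(E/K))) E, h1, ← hd, h3, one_mul]

theorem exists_sq_eq_of_nonneg {x : K} (hx : 0 ≤ x) : ∃ y, 0 ≤ y ∧ y ^ 2 = x := by
  obtain ⟨y, rfl⟩ := exists_eq_pow_of_nonneg hx two_ne_zero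
  exact ⟨|y|, abs_nonneg y, sq_abs y⟩

/-- Every `a + b i` is a square `(x + y i) ^ 2`. -/
theorem exists_complex_sqrt (a b : K) : ∃ x y : K, x ^ 2 - y ^ 2 = a ∧ 2 * x * y = b := by
  -- `r` is the modulus of `a + b i`; the half-sum and half-difference of `r` and `a` give `x ^ 2`
  -- and `y ^ 2`, and `b` fixes the sign of `y`.
  obtain ⟨r, hr, hr2⟩ := exists_sq_eq_of_nonneg (add_nonneg (sq_nonneg a) (sq_nonneg b))
  have har : |a| ≤ r := abs_le_of_sq_le_sq (by nlinarith [sq_nonneg b]) hr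
  obtain ⟨x, hx, hx2⟩ := exists_sq_eq_of_nonneg
    (show 0 ≤ (r + a) / 2 by linarith [neg_abs_le a])
  obtain ⟨y, hy, hy2⟩ := exists_sq_eq_of_nonneg
    (show 0 ≤ (r - a) / 2 by linarith [le_abs_self a])
  have h : (2 * x * y) ^ 2 = b ^ 2 := by
    rw [mul_pow, mul_pow, hx2, hy2]; linear_combination hr2
  rcases sq_eq_sq_iff_eq_or_eq_neg.1 h with h | h
  · exact ⟨x, y, by rw [hx2, hy2]; ring, h⟩
  · exact ⟨x, -y, by rw [neg_sq, hx2, hy2]; ring, by linear_combination -h⟩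

/-- Irreducible polynomials over a real closed field have degree at most two. -/
theorem natDegree_le_two_of_irreducible {p : K[X]} (hp : Irreducible p) : p.natDegree ≤ 2 := by
  have hX : (X ^ 2 + 1 : K[X]) ≠ 0 := (monic_X_pow_add_C (1 : K) two_ne_zero).ne_zero
  have hq : p * (X ^ 2 + 1) ≠ 0 := mul_ne_zero hp.ne_zero hX
  -- The extra factor puts `i` in `E`. All elements of `K(i)` are squares and `[E : K(i)]` is a
  -- power of 2, so `E = K(i)`.
  let E := (p * (X ^ 2 + 1)).SplittingField
  have : IsGalois K E := {}
  have hs := SplittingField.splits (p * (X ^ 2 + 1))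
  rw [Polynomial.map_mul, splits_mul (map_ne_zero hp.ne_zero) (map_ne_zero hX)] at hs
  obtain ⟨α, hα⟩ := hs.1.exists_eval_eq_zero (by
    rw [degree_map]; exact (degree_pos_of_irreducible hp).ne')
  obtain ⟨i, hi⟩ := hs.2.exists_eval_eq_zero (by
    rw [degree_map, degree_eq_natDegree hX]
    have : (X ^ 2 + 1 : K[X]).natDegree = 2 := natDegree_X_pow_add_C (r := (1 : K))
    rw [this]; norm_num)
  have hi : i ^ 2 = -1 := by
    simp only [Polynomial.map_add, Polynomial.map_pow, map_X, Polynomial.map_one, eval_add,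
      eval_pow, eval_X, eval_one] at hi
    linear_combination hi
  obtain ⟨n, hn⟩ := exists_finrank_eq_two_pow (K := K) E
  have h1 : finrank K⟮i⟯ E = 1 := by
    refine IsGalois.finrank_eq_one_of_forall_isSquare (n := n) (fun z => ?_)
      (by rw [← hn, ← finrank_mul_finrank K K⟮i⟯ E]; exact dvd_mul_left _ _)
    obtain ⟨a, b, hz⟩ :=
      IntermediateField.exists_eq_add_mul_of_mem_adjoin_of_sq_eq_neg_one hi z.2
    obtain ⟨x, y, rfl, rfl⟩ := exists_complex_sqrt a b
    refine ⟨⟨algebraMap K E x + algebraMap K E y * i, add_mem (K⟮i⟯.algebraMap_mem _)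
      (mul_mem (K⟮i⟯.algebraMap_mem _) (mem_adjoin_simple_self K i))⟩, Subtype.ext ?_⟩
    rw [hz]
    simp only [MulMemClass.mk_mul_mk, map_sub, map_mul, map_pow, map_ofNat]
    linear_combination -(algebraMap K E y) ^ 2 * hi
  have h2 : finrank K K⟮i⟯ ≤ 2 := by
    rw [adjoin.finrank (IsIntegral.of_finite K i)]
    have : (X ^ 2 + 1 : K[X]).natDegree = 2 := natDegree_X_pow_add_C (r := (1 : K))
    exact (natDegree_le_of_dvd (minpoly.dvd K i (by simp [hi])) hX).trans this.le
  calc p.natDegree = (minpoly K α).natDegree := by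
        rw [← minpoly.eq_of_irreducible hp (by rwa [aeval_def, ← eval_map]),
          natDegree_mul_C (inv_ne_zero (leadingCoeff_ne_zero.2 hp.ne_zero))]
    _ = finrank K K⟮α⟯ := (adjoin.finrank (IsIntegral.of_finite K α)).symm
    _ ≤ finrank K E := K⟮α⟯.toSubmodule.finrank_le
    _ = finrank K K⟮i⟯ * finrank K⟮i⟯ E := (finrank_mul_finrank K K⟮i⟯ E).symm
    _ ≤ 2 := by rw [h1, mul_one]; exact h2

end IsRealClosed

end RealClosed

/-! ### Uniqueness of factorizations modulo an ideal -/

section FiniteRing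

open Polynomial

theorem Polynomial.map_quotientMk_eq_zero_iff {R : Type*} [CommRing R] {I : Ideal R} {f : R[X]} :
    f.map (Ideal.Quotient.mk I) = 0 ↔ ∀ n, f.coeff n ∈ I := by
  simp [Polynomial.ext_iff, Ideal.Quotient.eq_zero_iff_mem]

theorem Polynomial.map_quotientMk_eq_iff {R : Type*} [CommRing R] {I : Ideal R} {f g : R[X]} :
    f.map (Ideal.Quotient.mk I) = g.map (Ideal.Quotient.mk I) ↔
      ∀ n, f.coeff n - g.coeff n ∈ I := by
  simp [Polynomial.ext_iff, Ideal.Quotient.eq]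

/-- Modulo an ideal `J`, a factorization `P * B` with `P` monic of given degree and `B` congruent
to `1` modulo an ideal in the Jacobson radical is unique. -/
theorem Polynomial.map_eq_and_map_eq_of_map_mul_eq {R : Type*} [CommRing R] {M J : Ideal R}
    (hM : M ≤ Ideal.jacobson ⊥) {P Q B C : R[X]} (hP : P.Monic) (hQ : Q.Monic)
    (hd : P.natDegree = Q.natDegree) (hC : C.map (Ideal.Quotient.mk M) = 1)
    (h : (P * B).map (Ideal.Quotient.mk J) = (Q * C).map (Ideal.Quotient.mk J)) :
    P.map (Ideal.Quotient.mk J) = Q.map (Ideal.Quotient.mk J) ∧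
      B.map (Ideal.Quotient.mk J) = C.map (Ideal.Quotient.mk J) := by
  set D := Q - P with hD
  have hC' : ∀ n, (C - 1).coeff n ∈ M :=
    map_quotientMk_eq_zero_iff.1 (by rw [Polynomial.map_sub, hC, Polynomial.map_one, sub_self])
  -- Modulo `J + M I`, `D` is the multiple `P * (B - C)` of the monic `P`, while its degree is
  -- smaller, so it vanishes. Thus `I ≤ J + M I`, and Nakayama gives `I ≤ J`.
  set I : Ideal R := Ideal.span (D.coeffs : Set R) with hI
  have hDI : ∀ n, D.coeff n ∈ I := fun n => by
    by_cases h0 : D.coeff n = 0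
    · rw [h0]; exact I.zero_mem
    · exact Ideal.subset_span (coeff_mem_coeffs h0)
  have hDC : (D * (C - 1)).map (Ideal.Quotient.mk (J ⊔ M • I)) = 0 := by
    refine map_quotientMk_eq_zero_iff.2 fun n => Ideal.mem_sup_right ?_
    rw [coeff_mul, smul_eq_mul]
    refine sum_mem fun x _ => ?_
    rw [mul_comm (D.coeff _)]
    exact Ideal.mul_mem_mul (hC' _) (hDI _)
  have hPC : (Q * C - P * B).map (Ideal.Quotient.mk (J ⊔ M • I)) = 0 :=
    map_quotientMk_eq_zero_iff.2 fun n => Ideal.mem_sup_left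
      (map_quotientMk_eq_zero_iff.1 (by rw [Polynomial.map_sub, h, sub_self]) n)
  have hdvd : P.map (Ideal.Quotient.mk (J ⊔ M • I)) ∣ D.map (Ideal.Quotient.mk (J ⊔ M • I)) := by
    refine ⟨(B - C).map (Ideal.Quotient.mk (J ⊔ M • I)), ?_⟩
    rw [← Polynomial.map_mul, ← sub_eq_zero, ← Polynomial.map_sub,
      show D - P * (B - C) = (Q * C - P * B) - D * (C - 1) by rw [hD]; ring, Polynomial.map_sub,
      hPC, hDC, sub_zero]
  have hD0 : D.map (Ideal.Quotient.mk (J ⊔ M • I)) = 0 := by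
    by_contra h0
    have hnt : Nontrivial (R ⧸ (J ⊔ M • I)) := Polynomial.nontrivial_iff.1 ⟨_, _, h0⟩
    have hnt' : Nontrivial R := (Ideal.Quotient.mk (J ⊔ M • I)).domain_nontrivial
    refine (hP.map _).not_dvd_of_degree_lt h0 ?_ hdvd
    rw [hP.degree_map]
    refine degree_map_le.trans_lt ?_
    have hdeg : Q.degree = P.degree := by
      rw [degree_eq_natDegree hQ.ne_zero, degree_eq_natDegree hP.ne_zero, hd]
    rw [← hdeg]
    exact degree_sub_lt_left hdeg hQ.ne_zero (by rw [hQ.leadingCoeff, hP.leadingCoeff])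
  have hIJ : I ≤ J := Submodule.le_of_le_smul_of_le_jacobson_bot ⟨D.coeffs, rfl⟩ hM <| by
    refine Ideal.span_le.2 fun x hx => ?_
    obtain ⟨n, -, rfl⟩ := mem_coeffs_iff.1 hx
    exact map_quotientMk_eq_zero_iff.1 hD0 n
  have hPQ : P.map (Ideal.Quotient.mk J) = Q.map (Ideal.Quotient.mk J) := by
    refine (sub_eq_zero.1 ?_).symm
    rw [← Polynomial.map_sub]
    exact map_quotientMk_eq_zero_iff.2 fun n => hIJ (hDI n)
  refine ⟨hPQ, ?_⟩
  rw [Polynomial.map_mul, Polynomial.map_mul, ← hPQ] at h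
  exact (hP.map _).isRegular.left h

/-! ### Finite elements and factorization of polynomials -/

namespace OrderedValuation

theorem IsInfinitesimal.of_abs_le {K : Type*} [Field K] [LinearOrder K] {L : Subfield K}
    {x y : K} (hy : IsInfinitesimal L y) (h : |x| ≤ |y|) :
    IsInfinitesimal L x :=
  fun a ha h0 => h.trans_lt (hy a ha h0)

variable {K : Type*} [Field K] [LinearOrder K] [IsStrictOrderedRing K] {L : Subfield K}

theorem mem_finiteRing_iff {x : K} : x ∈ finiteRing L ↔ ∃ a ∈ L, 0 < a ∧ |x| ≤ a :=
  not_isInfinitelyLarge_iff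

theorem IsInfinitesimal.mem_finiteRing {x : K} (hx : IsInfinitesimal L x) : x ∈ finiteRing L :=
  mem_finiteRing_iff.2 ⟨1, L.one_mem, one_pos, (hx 1 L.one_mem one_pos).le⟩

theorem mem_finiteRing_of_abs_le {x y : K} (hy : y ∈ finiteRing L) (h : |x| ≤ |y|) :
    x ∈ finiteRing L := by
  obtain ⟨a, ha, h0, hya⟩ := mem_finiteRing_iff.1 hy
  exact mem_finiteRing_iff.2 ⟨a, ha, h0, h.trans hya⟩

theorem isInfinitesimal_inv_of_notMem {x : K} (hx : x ∉ finiteRing L) : IsInfinitesimal L x⁻¹ := by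
  intro a ha h0
  have h : a⁻¹ < |x| := not_not.1 hx a⁻¹ (L.inv_mem ha) (inv_pos.2 h0)
  rw [abs_inv]
  exact inv_lt_of_inv_lt₀ h0 h

theorem inv_mem_finiteRing_of_not_isInfinitesimal {x : K} (hx : ¬ IsInfinitesimal L x) :
    x⁻¹ ∈ finiteRing L := by
  by_contra h
  exact hx (by simpa using isInfinitesimal_inv_of_notMem h)

/-- An element with infinitesimal square is infinitesimal. -/
theorem IsInfinitesimal.of_sq {x : K} (hx : IsInfinitesimal L (x ^ 2)) : IsInfinitesimal L x := by
  intro a ha h0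
  have h := hx (a ^ 2) (L.pow_mem ha 2) (by positivity)
  rw [abs_pow] at h
  exact lt_of_pow_lt_pow_left₀ 2 h0.le h

theorem mem_finiteRing_of_sq_mem {x : K} (hx : x ^ 2 ∈ finiteRing L) : x ∈ finiteRing L := by
  by_contra h
  refine hx fun a ha h0 => ?_
  have h1 : 1 < |x| := not_not.1 h 1 L.one_mem one_pos
  have h2 : a < |x| := not_not.1 h a ha h0
  rw [abs_pow]
  nlinarith

theorem one_notMem_infinitesimalIdeal : (1 : finiteRing L) ∉ infinitesimalIdeal L :=
  fun h => by simpa using h 1 L.one_mem one_pos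

instance : Nontrivial (finiteRing L ⧸ infinitesimalIdeal L) :=
  Ideal.Quotient.nontrivial_iff.2 ((Ideal.ne_top_iff_one _).2 one_notMem_infinitesimalIdeal)

/-- A finite element that is not infinitesimal has a finite inverse, so everything in `1 + M` is a
unit. -/
theorem infinitesimalIdeal_le_jacobson :
    infinitesimalIdeal L ≤ Ideal.jacobson (⊥ : Ideal (finiteRing L)) := by
  intro x hx
  refine Ideal.mem_jacobson_bot.2 fun y => ?_
  set z := x * y + 1 with hz
  have h : z ∉ infinitesimalIdeal L := fun h => one_notMem_infinitesimalIdeal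
    (((infinitesimalIdeal L).add_mem_iff_right (Ideal.mul_mem_right y _ hx)).1 h)
  have h0 : (z : K) ≠ 0 := fun h0 => h (by
    rw [show z = 0 from Subtype.ext h0]; exact zero_mem _)
  exact IsUnit.of_mul_eq_one ⟨(z : K)⁻¹, inv_mem_finiteRing_of_not_isInfinitesimal h⟩
    (Subtype.ext (mul_inv_cancel₀ h0))

/-- `F` is a constant times a monic polynomial with finite coefficients times a polynomial
congruent to `1` modulo infinitesimals. -/
def HasSplitting (L : Subfield K) (F : K[X]) : Prop :=
  ∃ (c : K) (P B : (finiteRing L)[X]), P.Monic ∧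
    B.map (Ideal.Quotient.mk (infinitesimalIdeal L)) = 1 ∧
    F = C c * P.map (finiteRing L).subtype * B.map (finiteRing L).subtype

theorem HasSplitting.mul {F G : K[X]} (hF : HasSplitting L F) (hG : HasSplitting L G) :
    HasSplitting L (F * G) := by
  obtain ⟨c, P, B, hP, hB, rfl⟩ := hF
  obtain ⟨d, Q, D, hQ, hD, rfl⟩ := hG
  refine ⟨c * d, P * Q, B * D, hP.mul hQ, by rw [Polynomial.map_mul, hB, hD, one_mul], ?_⟩
  simp only [Polynomial.map_mul, C_mul]
  ring

theorem HasSplitting.C (c : K) : HasSplitting L (C c) :=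
  ⟨c, 1, 1, monic_one, by simp, by simp⟩

/-- When `a` is infinitely large, write `X + a = a (1 + a⁻¹ X)`. -/
theorem hasSplitting_X_add_C (a : K) : HasSplitting L (X + Polynomial.C a) := by
  by_cases ha : a ∈ finiteRing L
  · exact ⟨1, X + Polynomial.C ⟨a, ha⟩, 1, monic_X_add_C _, by simp, by simp⟩
  · have hi := isInfinitesimal_inv_of_notMem ha
    have h0 : a ≠ 0 := fun h => ha (h ▸ zero_mem _)
    refine ⟨a, 1, 1 + Polynomial.C ⟨a⁻¹, hi.mem_finiteRing⟩ * X, monic_one, ?_, ?_⟩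
    · have : Ideal.Quotient.mk (infinitesimalIdeal L) ⟨a⁻¹, hi.mem_finiteRing⟩ = 0 :=
        Ideal.Quotient.eq_zero_iff_mem.2 hi
      simp [this]
    · simp [mul_add, ← mul_assoc, ← C_mul, h0, add_comm]

/-- The discriminant bound lets `b` control `a`: if `b` is finite so is `a`; otherwise dividing by
`b` makes both nonconstant coefficients infinitesimal, since `(a / b) ^ 2 ≤ 4 / b`. -/
theorem hasSplitting_quadratic {a b : K} (h : a ^ 2 < 4 * b) :
    HasSplitting L (X ^ 2 + Polynomial.C a * X + Polynomial.C b) := by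
  have hb0 : 0 < b := by nlinarith [sq_nonneg a]
  by_cases hb : b ∈ finiteRing L
  · have ha : a ∈ finiteRing L := by
      refine mem_finiteRing_of_sq_mem (mem_finiteRing_of_abs_le
        (mul_mem (ofNat_mem (finiteRing L) 4) hb) ?_)
      rw [abs_of_nonneg (sq_nonneg a), abs_of_pos (by positivity)]
      exact h.le
    refine ⟨1, X ^ 2 + (Polynomial.C ⟨a, ha⟩ * X + Polynomial.C ⟨b, hb⟩), 1, ?_, by simp, ?_⟩
    · exact monic_X_pow_add (degree_linear_le.trans_lt (by norm_num))
    · simp [add_assoc]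
  · have hi := isInfinitesimal_inv_of_notMem hb
    have h4 : IsInfinitesimal L (4 * b⁻¹) :=
      (infinitesimalIdeal L).mul_mem_left ⟨4, ofNat_mem (finiteRing L) 4⟩
        (show (⟨b⁻¹, hi.mem_finiteRing⟩ : finiteRing L) ∈ infinitesimalIdeal L from hi)
    have ha : IsInfinitesimal L (b⁻¹ * a) := by
      refine IsInfinitesimal.of_sq (h4.of_abs_le ?_)
      rw [abs_of_nonneg (sq_nonneg _), abs_of_pos (by positivity)]
      calc (b⁻¹ * a) ^ 2 = b⁻¹ ^ 2 * a ^ 2 := by ring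
        _ ≤ b⁻¹ ^ 2 * (4 * b) := mul_le_mul_of_nonneg_left h.le (sq_nonneg _)
        _ = 4 * b⁻¹ := by field_simp
    refine ⟨b, 1, Polynomial.C ⟨b⁻¹, hi.mem_finiteRing⟩ * X ^ 2 +
      Polynomial.C ⟨b⁻¹ * a, ha.mem_finiteRing⟩ * X + 1, monic_one, ?_, ?_⟩
    · have h1 : Ideal.Quotient.mk (infinitesimalIdeal L) ⟨b⁻¹, hi.mem_finiteRing⟩ = 0 :=
        Ideal.Quotient.eq_zero_iff_mem.2 hi
      have h2 : Ideal.Quotient.mk (infinitesimalIdeal L) ⟨b⁻¹ * a, ha.mem_finiteRing⟩ = 0 :=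
        Ideal.Quotient.eq_zero_iff_mem.2 ha
      simp [h1, h2]
    · have h1 : Polynomial.C b * Polynomial.C b⁻¹ = (1 : K[X]) := by
        rw [← C_mul, mul_inv_cancel₀ hb0.ne', C_1]
      simp only [Polynomial.map_one, Polynomial.map_add, Polynomial.map_mul, Polynomial.map_pow,
        map_X, map_C, Subring.subtype_apply, C_mul]
      linear_combination (-X ^ 2 - Polynomial.C a * X) * h1

variable [IsRealClosed K]

theorem hasSplitting_of_irreducible {q : K[X]} (hq : Irreducible q) (hm : q.Monic) :
    HasSplitting L q := by
  have hpos := hq.natDegree_pos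
  have hle := IsRealClosed.natDegree_le_two_of_irreducible hq
  rcases (show q.natDegree = 1 ∨ q.natDegree = 2 by omega) with hd | hd
  · rw [hm.eq_X_add_C hd]
    exact hasSplitting_X_add_C _
  · have hc : q.coeff 2 = 1 := by rw [← hd]; exact hm
    have h := not_isSquare_discrim_of_irreducible hq hm hd
    rw [← IsRealClosed.nonneg_iff_isSquare, not_le] at h
    have h' := hasSplitting_quadratic (L := L) (sub_neg.1 h)
    convert h'
    rw [eq_quadratic_of_degree_le_two (natDegree_le_iff_degree_le.1 hd.le)]
    simp [hc]

theorem hasSplitting (F : K[X]) : HasSplitting L F := by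
  induction F using WfDvdMonoid.induction_on_irreducible with
  | zero => simpa using HasSplitting.C (L := L) 0
  | unit u hu =>
    obtain ⟨c, -, rfl⟩ := Polynomial.isUnit_iff.1 hu
    exact HasSplitting.C c
  | mul a i ha hi ih =>
    have h0 : i.leadingCoeff ≠ 0 := leadingCoeff_ne_zero.2 hi.ne_zero
    have hn : HasSplitting L (i * Polynomial.C i.leadingCoeff⁻¹) :=
      hasSplitting_of_irreducible (irreducible_mul_leadingCoeff_inv.2 hi)
        (monic_mul_leadingCoeff_inv hi.ne_zero)
    have h := (hn.mul (HasSplitting.C i.leadingCoeff)).mul ih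
    rwa [mul_assoc i, ← C_mul, inv_mul_cancel₀ h0, C_1, mul_one] at h

/-- Hensel factorization over the ring of finite elements of a real closed field. -/
theorem exists_monic_mul_eq {F : (finiteRing L)[X]}
    (hF : (F.map (Ideal.Quotient.mk (infinitesimalIdeal L))).Monic) :
    ∃ P B : (finiteRing L)[X], P.Monic ∧
      B.map (Ideal.Quotient.mk (infinitesimalIdeal L)) = 1 ∧ P * B = F := by
  obtain ⟨c, P, B, hP, hB, h⟩ := hasSplitting (L := L) (F.map (finiteRing L).subtype)
  have hinj : Function.Injective (Polynomial.map (finiteRing L).subtype) :=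
    map_injective _ (finiteRing L).subtype_injective
  have hPm := hP.map (Ideal.Quotient.mk (infinitesimalIdeal L))
  by_cases hc : c ∈ finiteRing L
  · have hF' : F = C ⟨c, hc⟩ * P * B := hinj (by simpa using h)
    have h1 := congrArg (Polynomial.map (Ideal.Quotient.mk (infinitesimalIdeal L))) hF'
    rw [Polynomial.map_mul, Polynomial.map_mul, hB, mul_one, map_C] at h1
    -- Comparing leading coefficients mod `M` gives `c ≡ 1`, so `c` can be absorbed into `B`.
    have h2 : Ideal.Quotient.mk (infinitesimalIdeal L) ⟨c, hc⟩ = 1 := by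
      have := hF.leadingCoeff
      rwa [h1, leadingCoeff_mul_monic hPm, leadingCoeff_C] at this
    refine ⟨P, C ⟨c, hc⟩ * B, hP, ?_, ?_⟩
    · rw [Polynomial.map_mul, hB, map_C, h2, C_1, one_mul]
    · rw [hF']; ring
  · exfalso
    -- Dividing by `c` and reducing mod `M` would give `0 = P` with `P` monic.
    have hi := isInfinitesimal_inv_of_notMem hc
    have h0 : c ≠ 0 := fun h => hc (h ▸ zero_mem _)
    have hF' : C ⟨c⁻¹, hi.mem_finiteRing⟩ * F = P * B := hinj (by
      simp [h, ← mul_assoc, ← C_mul, h0])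
    have h1 := congrArg (Polynomial.map (Ideal.Quotient.mk (infinitesimalIdeal L))) hF'
    rw [Polynomial.map_mul, Polynomial.map_mul, hB, mul_one, map_C,
      Ideal.Quotient.eq_zero_iff_mem.2 (show (⟨c⁻¹, hi.mem_finiteRing⟩ : finiteRing L) ∈
        infinitesimalIdeal L from hi), C_0, zero_mul] at h1
    exact hPm.ne_zero h1.symm

end OrderedValuation

/-! ### Topology of principal ideals and passage to the limit -/

namespace OrderedValuation

variable {K : Type*} [Field K] [LinearOrder K] [IsStrictOrderedRing K] {L : Subfield K}

/-- The quotient `x / b` has absolute value at most 1, hence is finite. -/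
theorem mem_span_singleton_of_abs_le {x b : finiteRing L} (hb : b ≠ 0)
    (h : |(x : K)| ≤ |(b : K)|) : x ∈ Ideal.span {b} := by
  have hb' : (b : K) ≠ 0 := fun h => hb (Subtype.ext h)
  have hq : (x : K) / b ∈ finiteRing L := mem_finiteRing_of_abs_le (one_mem _) (by
    rw [abs_div, abs_one]
    exact div_le_one_of_le₀ h (abs_nonneg _))
  exact Ideal.mem_span_singleton.2 ⟨⟨_, hq⟩, Subtype.ext (mul_div_cancel₀ _ hb').symm⟩

theorem NonComparable.exists_isInfinitesimal_pos (hL : NonComparable L) :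
    ∃ m : K, 0 < m ∧ IsInfinitesimal L m := by
  obtain ⟨x, hx⟩ := hL
  have h0 : 0 < x := hx 0 L.zero_mem
  refine ⟨x⁻¹, inv_pos.2 h0, isInfinitesimal_inv_of_notMem (not_not.2 fun a ha _ => ?_)⟩
  exact (hx a ha).trans_le (le_abs_self x)

theorem NonComparable.exists_ne_zero_mem (hL : NonComparable L) :
    ∃ b ∈ infinitesimalIdeal L, b ≠ 0 := by
  obtain ⟨m, h0, hm⟩ := hL.exists_isInfinitesimal_pos
  exact ⟨⟨m, hm.mem_finiteRing⟩, hm, fun h => h0.ne' (congrArg Subtype.val h)⟩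

/-- The nonzero principal ideals of the ring of finite elements are arbitrarily small. -/
theorem NonComparable.exists_span_abs_lt (hL : NonComparable L) {ε : K} (hε : 0 < ε) :
    ∃ b : finiteRing L, b ≠ 0 ∧ ∀ x ∈ Ideal.span {b}, |(x : K)| < ε := by
  obtain ⟨m, h0, hm⟩ := hL.exists_isInfinitesimal_pos
  -- The minimum with 1 keeps the generator finite; the factor `m` absorbs any finite multiplier
  -- `c`, as `|m * c| < 1`.
  have hmin : 0 < min ε 1 := lt_min hε one_pos
  have he : min ε 1 ∈ finiteRing L := mem_finiteRing_of_abs_le (one_mem _) (by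
    rw [abs_one, abs_of_pos hmin]; exact min_le_right _ _)
  refine ⟨⟨_, he⟩ * ⟨m, hm.mem_finiteRing⟩,
    fun h => (mul_pos hmin h0).ne' (congrArg Subtype.val h), fun x hx => ?_⟩
  obtain ⟨c, rfl⟩ := Ideal.mem_span_singleton.1 hx
  have hmc : |m * (c : K)| < 1 :=
    (infinitesimalIdeal L).mul_mem_right c (show ⟨m, hm.mem_finiteRing⟩ ∈ infinitesimalIdeal L
      from hm) 1 L.one_mem one_pos
  calc |min ε 1 * m * (c : K)| = min ε 1 * |m * (c : K)| := by
        rw [mul_assoc, abs_mul, abs_of_pos hmin]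
    _ < min ε 1 * 1 := mul_lt_mul_of_pos_left hmc hmin
    _ ≤ ε := by rw [mul_one]; exact min_le_left _ _

theorem NonComparable.eq_zero_of_forall_mem_span (hL : NonComparable L) {x : finiteRing L}
    (h : ∀ b : finiteRing L, b ≠ 0 → x ∈ Ideal.span {b}) : x = 0 := by
  by_contra hx
  obtain ⟨b, hb, hlt⟩ := hL.exists_span_abs_lt
    (abs_pos.2 fun h0 => hx (Subtype.ext h0) : 0 < |(x : K)|)
  exact lt_irrefl _ (hlt x (h b hb))

theorem NonComparable.isRestricted_iff [TopologicalSpace K] [OrderTopology K]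
    (hL : NonComparable L) {F : PowerSeries (finiteRing L)} :
    RestrictedSeries.IsRestricted F ↔ ∀ b : finiteRing L, b ≠ 0 →
      ∃ n₀, ∀ n, n₀ ≤ n → PowerSeries.coeff n F ∈ Ideal.span {b} := by
  rw [RestrictedSeries.IsRestricted, tendsto_subtype_rng]
  constructor
  · intro h b hb
    have hb' : 0 < |(b : K)| := abs_pos.2 fun h => hb (Subtype.ext h)
    obtain ⟨n₀, hn⟩ := Filter.eventually_atTop.1 (h.eventually (eventually_abs_sub_lt _ hb'))
    exact ⟨n₀, fun n hle => mem_span_singleton_of_abs_le hb (by simpa using (hn n hle).le)⟩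
  · intro h
    refine tendsto_order.2 ⟨fun a ha => ?_, fun a ha => ?_⟩
    · obtain ⟨b, hb, hlt⟩ := hL.exists_span_abs_lt (neg_pos.2 (show a < 0 from ha))
      obtain ⟨n₀, hn⟩ := h b hb
      exact Filter.eventually_atTop.2
        ⟨n₀, fun n hle => neg_lt_neg_iff.1 ((neg_le_abs _).trans_lt (hlt _ (hn n hle)))⟩
    · obtain ⟨b, hb, hlt⟩ := hL.exists_span_abs_lt (show 0 < a from ha)
      obtain ⟨n₀, hn⟩ := h b hb
      exact Filter.eventually_atTop.2
        ⟨n₀, fun n hle => (le_abs_self _).trans_lt (hlt _ (hn n hle))⟩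

/-- Completeness of the ring of finite elements for the topology of its nonzero principal ideals;
the limit is attained with the same modulus of convergence. -/
theorem NonComparable.exists_forall_sub_mem_span [CauSeq.IsComplete K (abs : K → K)]
    (hL : NonComparable L) (u : ℕ → finiteRing L)
    (hu : ∀ b : finiteRing L, b ≠ 0 →
      ∃ n₀, ∀ n m, n₀ ≤ n → n₀ ≤ m → u n - u m ∈ Ideal.span {b}) :
    ∃ x : finiteRing L, ∀ b : finiteRing L, b ≠ 0 → ∀ n₀,
      (∀ n m, n₀ ≤ n → n₀ ≤ m → u n - u m ∈ Ideal.span {b}) →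
        ∀ n, n₀ ≤ n → x - u n ∈ Ideal.span {b} := by
  have hc : IsCauSeq (abs : K → K) fun n => (u n : K) := fun ε hε => by
    obtain ⟨b, hb, hlt⟩ := hL.exists_span_abs_lt hε
    obtain ⟨n₀, hn⟩ := hu b hb
    exact ⟨n₀, fun n hle => hlt _ (hn n n₀ hle le_rfl)⟩
  obtain ⟨x, hx⟩ := CauSeq.complete (⟨_, hc⟩ : CauSeq K abs)
  have hlim : ∀ ε > 0, ∃ i, ∀ j ≥ i, |(u j : K) - x| < ε := hx
  have hxA : x ∈ finiteRing L := by
    obtain ⟨i, hi⟩ := hlim 1 one_pos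
    have h : (u i : K) - x ∈ finiteRing L :=
      mem_finiteRing_of_abs_le (one_mem _) (by rw [abs_one]; exact (hi i le_rfl).le)
    simpa using sub_mem (u i).2 h
  refine ⟨⟨x, hxA⟩, fun b hb n₀ hn n hle => ?_⟩
  obtain ⟨i, hi⟩ := hlim |(b : K)| (abs_pos.2 fun h => hb (Subtype.ext h))
  -- The auxiliary index is both close to the limit and past `n₀`, so the estimate holds from `n₀`
  -- itself.
  have h1 : u (max i n₀) - ⟨x, hxA⟩ ∈ Ideal.span {b} :=
    mem_span_singleton_of_abs_le hb (hi _ (le_max_left _ _)).le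
  rw [show ⟨x, hxA⟩ - u n = (u (max i n₀) - u n) - (u (max i n₀) - ⟨x, hxA⟩) by ring]
  exact sub_mem (hn _ _ (le_max_right _ _) hle) h1

/-- Weierstrass factorization of restricted power series over the ring of finite elements of a
complete real closed field. -/
theorem NonComparable.exists_weierstrass_factorization [TopologicalSpace K] [OrderTopology K]
    [IsRealClosed K] [CauSeq.IsComplete K (abs : K → K)] (hL : NonComparable L)
    (S : PowerSeries (finiteRing L)) (hS : RestrictedSeries.IsRestricted S) (N : ℕ)
    (hmonic : (PowerSeries.trunc (N + 1) S).Monic)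
    (htail : ∀ h : ℕ, 1 ≤ h → PowerSeries.coeff (N + h) S ∈ infinitesimalIdeal L) :
    ∃ (P : (finiteRing L)[X]) (B : PowerSeries (finiteRing L)),
      S = (P : PowerSeries (finiteRing L)) * B ∧ P.Monic ∧
      P.map (Ideal.Quotient.mk (infinitesimalIdeal L)) =
        (PowerSeries.trunc (N + 1) S).map (Ideal.Quotient.mk (infinitesimalIdeal L)) ∧
      RestrictedSeries.IsRestricted B ∧
      B - 1 ∈ RestrictedSeries.restrictedIn (infinitesimalIdeal L) := by
  set M := infinitesimalIdeal L
  set T := PowerSeries.trunc (N + 1) S with hT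
  -- The coefficient of index `N` may vanish, so `d` can be smaller than `N`.
  set d := T.natDegree with hd
  -- The shift makes every `F n` contain all of `T`, so they are all congruent to `T` mod `M`.
  set F : ℕ → (finiteRing L)[X] := fun n => PowerSeries.trunc (n + (N + 1)) S with hF
  have hFT : ∀ n, (F n).map (Ideal.Quotient.mk M) = T.map (Ideal.Quotient.mk M) := fun n => by
    refine map_quotientMk_eq_iff.2 fun k => ?_
    rw [hF, hT, PowerSeries.coeff_trunc, PowerSeries.coeff_trunc]
    by_cases h1 : k < N + 1
    · rw [if_pos h1, if_pos (by omega), sub_self]; exact M.zero_mem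
    · rw [if_neg h1, sub_zero]
      split_ifs
      · have := htail (k - N) (by omega)
        rwa [Nat.add_sub_cancel' (by omega)] at this
      · exact M.zero_mem
  choose P B hP hB hPB using fun n => exists_monic_mul_eq (L := L) (F := F n)
    (by rw [hFT]; exact hmonic.map _)
  have hPT : ∀ n, (P n).map (Ideal.Quotient.mk M) = T.map (Ideal.Quotient.mk M) := fun n => by
    rw [← hFT n, ← hPB n, Polynomial.map_mul, hB, mul_one]
  have hPd : ∀ n, (P n).natDegree = d := fun n => by
    rw [hd, ← hmonic.natDegree_map (Ideal.Quotient.mk M), ← hPT n, (hP n).natDegree_map]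
  -- The index `n₀` does not depend on the coefficient `k`.
  have hcong : ∀ b : finiteRing L, b ≠ 0 → ∃ n₀, (∀ n, n₀ ≤ n → ∀ k,
      PowerSeries.coeff k S - (F n).coeff k ∈ Ideal.span {b}) ∧
      ∀ n m, n₀ ≤ n → n₀ ≤ m →
        (∀ k, (P n).coeff k - (P m).coeff k ∈ Ideal.span {b}) ∧
          ∀ k, (B n).coeff k - (B m).coeff k ∈ Ideal.span {b} := by
    intro b hb
    obtain ⟨n₀, hn⟩ := hL.isRestricted_iff.1 hS b hb
    have hSF : ∀ n, n₀ ≤ n → ∀ k,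
        PowerSeries.coeff k S - (F n).coeff k ∈ Ideal.span {b} := fun n hle k => by
      rw [hF, PowerSeries.coeff_trunc]
      split_ifs with h
      · rw [sub_self]; exact zero_mem _
      · rw [sub_zero]; exact hn k (by omega)
    refine ⟨n₀, hSF, fun n m hle hle' => ?_⟩
    rw [← map_quotientMk_eq_iff, ← map_quotientMk_eq_iff]
    refine map_eq_and_map_eq_of_map_mul_eq infinitesimalIdeal_le_jacobson (hP n) (hP m)
      (by rw [hPd, hPd]) (hB m) ?_
    rw [hPB, hPB]
    refine map_quotientMk_eq_iff.2 fun k => ?_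
    have := sub_mem (hSF m hle' k) (hSF n hle k)
    rwa [sub_sub_sub_cancel_left] at this
  choose p hp using fun k => hL.exists_forall_sub_mem_span (fun n => (P n).coeff k)
    fun b hb => (hcong b hb).imp fun n₀ h n m hn hm => (h.2 n m hn hm).1 k
  choose β hβ using fun k => hL.exists_forall_sub_mem_span (fun n => (B n).coeff k)
    fun b hb => (hcong b hb).imp fun n₀ h n m hn hm => (h.2 n m hn hm).2 k
  set P' : (finiteRing L)[X] := PowerSeries.trunc (d + 1) (PowerSeries.mk p) with hP'
  set B' : PowerSeries (finiteRing L) := PowerSeries.mk β with hB'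
  have hP'c : ∀ k, k < d + 1 → P'.coeff k = p k := fun k hk => by
    rw [hP', PowerSeries.coeff_trunc, if_pos hk, PowerSeries.coeff_mk]
  have hP'd : P'.natDegree ≤ d := Nat.lt_succ_iff.1 (PowerSeries.natDegree_trunc_lt _ _)
  have happ : ∀ b : finiteRing L, b ≠ 0 → ∃ n,
      (∀ k, PowerSeries.coeff k S - (F n).coeff k ∈ Ideal.span {b}) ∧
      (∀ k, P'.coeff k - (P n).coeff k ∈ Ideal.span {b}) ∧
      ∀ k, PowerSeries.coeff k B' - (B n).coeff k ∈ Ideal.span {b} := by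
    intro b hb
    obtain ⟨n₀, hSF, hPBc⟩ := hcong b hb
    refine ⟨n₀, hSF n₀ le_rfl, fun k => ?_, fun k => ?_⟩
    · by_cases hk : k < d + 1
      · rw [hP'c k hk]
        exact hp k b hb n₀ (fun n m hn hm => (hPBc n m hn hm).1 k) n₀ le_rfl
      · rw [coeff_eq_zero_of_natDegree_lt (by omega),
          coeff_eq_zero_of_natDegree_lt (by rw [hPd]; omega), sub_self]
        exact zero_mem _
    · rw [hB', PowerSeries.coeff_mk]
      exact hβ k b hb n₀ (fun n m hn hm => (hPBc n m hn hm).2 k) n₀ le_rfl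
  -- Approximation modulo a nonzero infinitesimal carries the congruences mod `M` over to the
  -- limits.
  obtain ⟨b₀, hb₀M, hb₀⟩ := hL.exists_ne_zero_mem
  have hb₀le : Ideal.span {b₀} ≤ M := (Ideal.span_singleton_le_iff_mem _).2 hb₀M
  obtain ⟨n₀, -, hPn, hBn⟩ := happ b₀ hb₀
  have hB1 : ∀ k, PowerSeries.coeff k (B' - 1) ∈ M := fun k => by
    have h := (map_quotientMk_eq_iff (g := 1)).1 (by rw [hB n₀, Polynomial.map_one]) k
    rw [map_sub, ← Polynomial.coe_one, Polynomial.coeff_coe]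
    simpa using add_mem (hb₀le (hBn k)) h
  -- Modulo `b` the series `B'` is the polynomial `B n`, so its coefficients beyond that degree lie
  -- in `(b)`.
  have hBres : ∀ b : finiteRing L, b ≠ 0 →
      ∃ n₁, ∀ n, n₁ ≤ n → PowerSeries.coeff n B' ∈ Ideal.span {b} := fun b hb => by
    obtain ⟨n, -, -, h⟩ := happ b hb
    refine ⟨(B n).natDegree + 1, fun k hk => ?_⟩
    simpa [coeff_eq_zero_of_natDegree_lt (show (B n).natDegree < k by omega)] using h k
  refine ⟨P', B', ?_, ?_, ?_, hL.isRestricted_iff.2 hBres, hL.isRestricted_iff.2 ?_, hB1⟩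
  · ext k : 1
    -- The nonzero principal ideals intersect in `0`, so it suffices to compare modulo each `b`.
    refine sub_eq_zero.1 (hL.eq_zero_of_forall_mem_span fun b hb => ?_)
    obtain ⟨n, h1, h2, h3⟩ := happ b hb
    have e1 : S.map (Ideal.Quotient.mk (Ideal.span {b})) =
        (F n : PowerSeries (finiteRing L)).map (Ideal.Quotient.mk (Ideal.span {b})) := by
      ext k; simpa [Ideal.Quotient.eq] using h1 k
    have e2 : (P' : PowerSeries (finiteRing L)).map (Ideal.Quotient.mk (Ideal.span {b})) =
        (P n : PowerSeries (finiteRing L)).map (Ideal.Quotient.mk (Ideal.span {b})) := by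
      ext k; simpa [Ideal.Quotient.eq] using h2 k
    have e3 : B'.map (Ideal.Quotient.mk (Ideal.span {b})) =
        (B n : PowerSeries (finiteRing L)).map (Ideal.Quotient.mk (Ideal.span {b})) := by
      ext k; simpa [Ideal.Quotient.eq] using h3 k
    have e : S.map (Ideal.Quotient.mk (Ideal.span {b})) =
        ((P' : PowerSeries (finiteRing L)) * B').map (Ideal.Quotient.mk (Ideal.span {b})) := by
      rw [map_mul, e2, e3, ← map_mul, ← Polynomial.coe_mul, hPB, e1]
    have := congrArg (PowerSeries.coeff k) e
    rwa [PowerSeries.coeff_map, PowerSeries.coeff_map, Ideal.Quotient.eq] at this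
  · refine monic_of_natDegree_le_of_coeff_eq_one d hP'd
      (sub_eq_zero.1 (hL.eq_zero_of_forall_mem_span fun b hb => ?_))
    obtain ⟨n, -, h, -⟩ := happ b hb
    have h1 : (P n).coeff d = 1 := by rw [← hPd n]; exact hP n
    rw [← h1]
    exact h d
  · rw [← hPT n₀]
    exact map_quotientMk_eq_iff.2 fun k => hb₀le (hPn k)
  · intro b hb
    obtain ⟨n₁, h⟩ := hBres b hb
    -- The `+ 1` excludes `k = 0`, the only index where subtracting `1` matters.
    refine ⟨n₁ + 1, fun k hk => ?_⟩
    rw [map_sub, PowerSeries.coeff_one, if_neg (by omega), sub_zero]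
    exact h k (by omega)

end OrderedValuation

end FiniteRing

theorem corollary5p3 {K : Type*} [Field K] [LinearOrder K] [IsStrictOrderedRing K]
    [TopologicalSpace K] [OrderTopology K] [FirstCountableTopology K]
    [IsRealClosed K] [CauSeq.IsComplete K (abs : K → K)]
    (L : Subfield K) (hL : OrderedValuation.NonComparable L)
    (S : PowerSeries (OrderedValuation.finiteRing L))
    (hS : RestrictedSeries.IsRestricted S) (N : ℕ)
    (hmonic : (PowerSeries.trunc (N + 1) S).Monic)
    (htail : ∀ h : ℕ, 1 ≤ h →
      PowerSeries.coeff (N + h) S ∈ OrderedValuation.infinitesimalIdeal L) :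
    ∃ (P : Polynomial (OrderedValuation.finiteRing L))
      (B : PowerSeries (OrderedValuation.finiteRing L)),
      S = (P : PowerSeries (OrderedValuation.finiteRing L)) * B ∧
      P.Monic ∧
      P.map (Ideal.Quotient.mk (OrderedValuation.infinitesimalIdeal L)) =
        (PowerSeries.trunc (N + 1) S).map
          (Ideal.Quotient.mk (OrderedValuation.infinitesimalIdeal L)) ∧
      RestrictedSeries.IsRestricted B ∧
      B - 1 ∈ RestrictedSeries.restrictedIn (OrderedValuation.infinitesimalIdeal L) :=
  hL.exists_weierstrass_factorization S hS N hmonic htail
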